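/- All graphs are finite and simple. For a graph $G$ with vertex set $V$ and $S \subseteq V$, $v \in S$, let $\mathrm{pn}_G[v,S] = \{w \in V : N_G[w] \cap S = \{v\}\}$, where $N_G[w]$ is the closed neighborhood of $w$. The set $S$ is irredundant if $\mathrm{pn}_G[v,S] \neq \emptyset$ for every $v \in S$; $\mathrm{IR}(G)$ is the maximum cardinality of an irredundant set of $G$, and an $\mathrm{IR}$-set of $G$ is an irredundant set of cardinality $\mathrm{IR}(G)$. A vertex is simplicial if its neighborhood induces a complete graph. The clique graph of $G$ has the maximal complete subgraphs of $G$ as vertices, two distinct ones being adjacent if and only if they intersect. The corona of a graph is obtained by adding, for each vertex $v$, a new vertex $v'$ and the edge $vv'$. The family $\mathcal F$ consists of the graphs $G$ obtained (up to isomorphism) as follows. Let $T_1,\dots,T_q$ be $q \ge 1$ trees, each of order at least $2$, and let $L_i$ be the line graph of the corona of $T_i$. If $q = 1$, let $G = L_1$. If $q \ge 2$, choose $q-1$ pairs of vertices such that the two members of each pair are simplicial vertices of $L_i$ and $L_j$, respectively, for some $i \ne j$ (depending on the pair); the $2(q-1)$ vertices in these pairs are all distinct; and contracting each pair in the disjoint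 union of $L_1,\dots,L_q$ into one common vertex results in a graph whose clique graph is a tree. Let $G$ be this contracted graph. For a graph $G$ of order $n$, a partition of $V(G)$ into sets $A$ and $B$ is called associated with $G$ if $|A| = \frac12(n-1)$, $|B| = \frac12(n+1)$, $B$ is an independent set, and each vertex in $A$ has exactly two neighbors in $B$. Lemma 5.5. Let $G \in \mathcal F$. Then there is a partition associated with $G$, and for every partition $(A,B)$ associated with $G$, the set $B$ is the unique $\mathrm{IR}$-set of $G$. -/

import Mathlib

namespace Favaron

universe u

/-! ### Irredundance -/

/-- The closed neighborhood `N_G[v]`. -/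
def closedNeighborSet {V : Type u} (G : SimpleGraph V) (v : V) : Set V :=
  insert v (G.neighborSet v)

/-- The `S`-private neighborhood `pn_G[v, S] = {w | N_G[w] ∩ S = {v}}`. -/
def privateNeighborSet {V : Type u} (G : SimpleGraph V) (v : V) (S : Set V) : Set V :=
  {w | closedNeighborSet G w ∩ S = {v}}

/-- `S` is irredundant: each of its vertices has an `S`-private neighbor. -/
def IsIrredundant {V : Type u} (G : SimpleGraph V) (S : Set V) : Prop :=
  ∀ v ∈ S, (privateNeighborSet G v S).Nonempty

/-- The upper irredundance number `IR(G)`, the maximum cardinality of an irredundant set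
(used for finite graphs, where the supremum is attained). -/
noncomputable def upperIrredundance {V : Type u} (G : SimpleGraph V) : ℕ :=
  sSup {k | ∃ S : Set V, IsIrredundant G S ∧ S.ncard = k}

/-- An `IR`-set: an irredundant set of cardinality `IR(G)`. -/
def IsIRSet {V : Type u} (G : SimpleGraph V) (S : Set V) : Prop :=
  IsIrredundant G S ∧ S.ncard = upperIrredundance G

/-! ### The ingredients of the family -/

/-- The corona of `G`: for each vertex `v` (here `Sum.inl v`) a new vertex `v'` (here `Sum.inr v`)
and the edge `v v'` are added. -/
def corona {V : Type u} (G : SimpleGraph V) : SimpleGraph (V ⊕ V) where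
  Adj a b :=
    match a, b with
    | Sum.inl v, Sum.inl w => G.Adj v w
    | Sum.inl v, Sum.inr w => v = w
    | Sum.inr v, Sum.inl w => v = w
    | Sum.inr _, Sum.inr _ => False
  symm := ⟨by
    rintro (v | v) (w | w) h
    · exact SimpleGraph.Adj.symm h
    · exact Eq.symm h
    · exact Eq.symm h
    · exact h⟩
  loopless := ⟨by
    rintro (v | v) h
    · exact G.loopless.irrefl v h
    · exact h⟩

/-- A simplicial vertex: its neighborhood induces a complete subgraph. -/
def IsSimplicial {V : Type u} (G : SimpleGraph V) (v : V) : Prop :=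
  G.IsClique (G.neighborSet v)

/-- The clique graph of `G`: its vertices are the maximal complete subgraphs of `G`, and two
distinct ones are adjacent if and only if they intersect. -/
def cliqueGraph {V : Type u} (G : SimpleGraph V) : SimpleGraph {s : Set V // Maximal G.IsClique s} where
  Adj s t := s ≠ t ∧ ((s : Set V) ∩ (t : Set V)).Nonempty
  symm := ⟨fun _ _ h => ⟨h.1.symm, by rw [Set.inter_comm]; exact h.2⟩⟩
  loopless := ⟨fun _ h => h.1 rfl⟩

/-- The disjoint union of a family of graphs. -/
def disjointUnion {ι : Type} {V : ι → Type u} (L : ∀ i, SimpleGraph (V i)) :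
    SimpleGraph (Σ i, V i) where
  Adj a b := ∃ (i : ι) (v w : V i), (L i).Adj v w ∧ a = ⟨i, v⟩ ∧ b = ⟨i, w⟩
  symm := ⟨fun _ _ ⟨i, v, w, h, ha, hb⟩ => ⟨i, w, v, h.symm, hb, ha⟩⟩
  loopless := ⟨by
    rintro a ⟨i, v, w, h, rfl, hb⟩
    obtain rfl : v = w := by simpa using hb
    exact (L i).loopless.irrefl v h⟩

/-- The vertices of `G` after identification of `x k` with `y k` for every `k`. -/
abbrev ContractedVertex {V : Type u} {κ : Type} (x y : κ → V) : Type u :=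
  Quot (fun a b : V => ∃ k, a = x k ∧ b = y k)

/-- The simple graph obtained from `G` by contracting, for every `k`, the vertices `x k` and `y k`
into one common vertex: distinct classes are adjacent if and only if they have adjacent
representatives. -/
def contractPairs {V : Type u} {κ : Type} (G : SimpleGraph V) (x y : κ → V) :
    SimpleGraph (ContractedVertex x y) :=
  G.map (Quot.mk _)

/-! ### The family -/

/-- The data from which a graph of the family is constructed. The graph `L i` is the line graph of
the corona of the tree `T i`, and `x k`, `y k` is the `k`-th chosen pair of vertices. -/
structure Construction where
  /-- The number of trees. -/
  q : ℕ
  one_le_q : 1 ≤ q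
  /-- The vertex sets of the trees. -/
  W : Fin q → Type
  finite : ∀ i, Finite (W i)
  nontrivial : ∀ i, Nontrivial (W i)
  /-- The trees. -/
  T : ∀ i, SimpleGraph (W i)
  isTree : ∀ i, (T i).IsTree
  /-- The first members of the `q - 1` chosen pairs. -/
  x : Fin (q - 1) → Σ i, (corona (T i)).edgeSet
  /-- The second members of the `q - 1` chosen pairs. -/
  y : Fin (q - 1) → Σ i, (corona (T i)).edgeSet
  x_simplicial : ∀ k, IsSimplicial (corona (T (x k).1)).lineGraph (x k).2
  y_simplicial : ∀ k, IsSimplicial (corona (T (y k).1)).lineGraph (y k).2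
  x_ne_y_component : ∀ k, (x k).1 ≠ (y k).1
  /-- The `2 (q - 1)` vertices of the pairs are all distinct. -/
  all_distinct : Function.Injective (Sum.elim x y)
  cliqueGraph_isTree : 2 ≤ q →
    (cliqueGraph (contractPairs (disjointUnion fun i => (corona (T i)).lineGraph) x y)).IsTree

/-- The graph constructed from the data. For `q = 1` there are no pairs to contract. -/
def Construction.graph (D : Construction) : SimpleGraph (ContractedVertex D.x D.y) :=
  contractPairs (disjointUnion fun i => (corona (D.T i)).lineGraph) D.x D.y

/-- Membership in Favaron's family, up to isomorphism. -/
def InFamily {V : Type u} (G : SimpleGraph V) : Prop :=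
  ∃ D : Construction, Nonempty (G ≃g D.graph)

/-- `(A, B)` is a partition associated with `G`, where `n = Nat.card V`:
`|A| = (n - 1) / 2`, `|B| = (n + 1) / 2`, `B` is independent, and each vertex of `A` has exactly two
neighbors in `B`. -/
structure IsAssociatedPartition {V : Type u} (G : SimpleGraph V) (A B : Set V) : Prop where
  disjoint : Disjoint A B
  union_eq : A ∪ B = Set.univ
  card_A : 2 * A.ncard + 1 = Nat.card V
  card_B : 2 * B.ncard = Nat.card V + 1
  indep : G.IsIndepSet B
  two_neighbors : ∀ a ∈ A, (G.neighborSet a ∩ B).ncard = 2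

end Favaron

/-!
Write the contracted graph `G` as the line graph of a tree with a perfect matching. The vertices of
this tree are those of `T₁, …, T_q` and, in addition, the corona leaves whose edges are not
contracted. Its edges are those of the `T i`, one edge for each contracted pair, which joins the two
tree vertices whose leaf edges are identified, and the remaining leaf edges. Every vertex of some
`T i` is in exactly one leaf edge, contracted or not, so the leaf edges are a perfect matching `B`.
In the formalization the uncontracted leaf edge at `x` is the loop at `x`
(`Favaron.IsMatchedForestModel`).

The representing graph is acyclic because a tree vertex can be recovered from the clique of the
edges at it, which is a maximal clique of `G`: this embeds the graph on the tree vertices into the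
clique graph (`Favaron.Construction.isAcyclic_forest_of_two_le`).

In a forest, every nonempty set of edges covers more vertices than it has members. From this alone,
an irredundant set of edges has at most as many members as a perfect matching `B`, with equality
only for `B` (`Favaron.card_le_and_eq_of_isIrredundant`). The partition into the edges of the `T i`
and `B` is associated with `G` by counting. The second part of any associated partition is
independent, hence irredundant, and has the size of `B`, so it is `B` as well.
-/

namespace Favaron

universe u

/-! ### Irredundant sets of edges in a forest with a perfect matching -/

open Finset in
/-- A finite forest has fewer edges than vertices. -/
theorem card_lt_card_of_isAcyclic {X : Type*} [DecidableEq X] {H : SimpleGraph X}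
    (hH : H.IsAcyclic) (F : Finset (Sym2 X)) (hF : ∀ e ∈ F, e ∈ H.edgeSet) (U : Finset X)
    (hU : U.Nonempty) (hFU : ∀ e ∈ F, e.toFinset ⊆ U) : #F < #U := by
  classical
  have : Nonempty U := hU.to_subtype
  obtain ⟨K, hK, -, hT⟩ := SimpleGraph.connected_top.exists_isTree_le_of_le_of_isAcyclic
    le_top (hH.induce (U : Set X))
  have hcard := hT.card_edgeFinset
  have hsub : F ⊆ K.edgeFinset.image (Sym2.map Subtype.val) := by
    intro e he
    induction e with | _ x y
    have hx : x ∈ U := hFU _ he (by simp)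
    have hy : y ∈ U := hFU _ he (by simp)
    refine mem_image.2 ⟨s(⟨x, hx⟩, ⟨y, hy⟩), ?_, by simp⟩
    rw [SimpleGraph.mem_edgeFinset, SimpleGraph.mem_edgeSet]
    exact hK (hF _ he)
  have h1 := (card_le_card hsub).trans card_image_le
  have hcU : Fintype.card (U : Set X) = #U := by simp
  omega

/-- In terms of edge ends, a private neighbor of `v` is an edge that meets no member of `S`
other than `v`. -/
theorem exists_private_of_isIrredundant {E V : Type*} {G : SimpleGraph E} {ends : E → Finset V}
    (hne : ∀ e, (ends e).Nonempty)
    (hadj : ∀ e f, G.Adj e f ↔ e ≠ f ∧ ¬ Disjoint (ends e) (ends f)) {S : Set E}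
    (hS : IsIrredundant G S) {v : E} (hv : v ∈ S) :
    ∃ w, ∀ s ∈ S, ¬ Disjoint (ends w) (ends s) ↔ s = v := by
  obtain ⟨w, hw⟩ := hS v hv
  refine ⟨w, fun s hs => ?_⟩
  have key := Set.ext_iff.1 hw s
  simp only [closedNeighborSet, Set.mem_inter_iff, Set.mem_insert_iff, SimpleGraph.mem_neighborSet,
    hs, and_true, Set.mem_singleton_iff, hadj] at key
  rw [← key]
  by_cases h : s = w
  · subst h
    simpa using (hne s).ne_empty
  · simp [h, Ne.symm h]

open Finset in
/-- Suppose `G` is the line graph of a forest with edge set `E`, where the forest condition is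
expressed by: every nonempty set of edges covers more vertices than it has members. If `B` is a
perfect matching, then every irredundant set of edges has at most `#B` members, with equality only
for `B`.

The members of `S` that meet no other member form a matching; each of the others has a private
neighbor, which lies outside `S` and avoids that matching. If there are others, then together with
their private neighbors they are a forest outside the matching, and counting vertices gives
`2 * #S < 2 * #B`. If there are none, `S` is a matching, and two distinct perfect matchings have a
symmetric difference that covers only as many vertices as it has edges. -/
theorem card_le_and_eq_of_isIrredundant {E V : Type*} [DecidableEq E] [DecidableEq V]
    {G : SimpleGraph E} {ends : E → Finset V} (hcard : ∀ e, #(ends e) = 2)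
    (hadj : ∀ e f, G.Adj e f ↔ e ≠ f ∧ ¬ Disjoint (ends e) (ends f))
    (hforest : ∀ F : Finset E, F.Nonempty → #F < #(F.biUnion ends)) {B : Finset E}
    (hdisj : (B : Set E).PairwiseDisjoint ends) (hcover : ∀ e, ends e ⊆ B.biUnion ends)
    {S : Finset E} (hS : IsIrredundant G (S : Set E)) :
    #S ≤ #B ∧ (#S = #B → S = B) := by
  classical
  have hne : ∀ e, (ends e).Nonempty := fun e => card_pos.1 (by rw [hcard]; norm_num)
  have hmatch : ∀ M : Finset E, (M : Set E).PairwiseDisjoint ends →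
      #(M.biUnion ends) = 2 * #M := by
    intro M hM
    rw [card_biUnion hM, sum_congr rfl fun e _ => hcard e, sum_const, smul_eq_mul, mul_comm]
  have hsub : ∀ M : Finset E, M.biUnion ends ⊆ B.biUnion ends := fun M =>
    biUnion_subset.2 fun e _ => hcover e
  have hBcard := hmatch B hdisj
  set I := S.filter fun s => ∀ t ∈ S, t ≠ s → Disjoint (ends s) (ends t) with hI
  set R := S.filter fun s => ¬ ∀ t ∈ S, t ≠ s → Disjoint (ends s) (ends t) with hR
  have hIR : #I + #R = #S := card_filter_add_card_filter_not _
  have hIdisj : (I : Set E).PairwiseDisjoint ends := by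
    intro s hs t ht hst
    exact (mem_filter.1 hs).2 t (mem_filter.1 ht).1 hst.symm
  have hIcard := hmatch I hIdisj
  rcases R.eq_empty_or_nonempty with h0 | hRne
  · have hSI : S = I := by
      refine (filter_true_of_mem fun s hs => ?_).symm
      by_contra hcon
      have : s ∈ R := mem_filter.2 ⟨hs, hcon⟩
      simp [h0] at this
    rw [← hSI] at hIcard hIdisj
    have hle := card_le_card (hsub S)
    refine ⟨by omega, fun heq => ?_⟩
    have hUeq : S.biUnion ends = B.biUnion ends :=
      eq_of_subset_of_card_le (hsub S) (by omega)
    by_contra hSB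
    have hSd : (S \ B).Nonempty := by
      rw [sdiff_nonempty]
      exact fun h => hSB (eq_of_subset_of_card_le h heq.ge)
    have hF := hforest ((S \ B) ∪ (B \ S)) hSd.inl
    have hB' : (B \ S).biUnion ends ⊆ (S \ B).biUnion ends := by
      intro v hv
      obtain ⟨b, hb, hvb⟩ := mem_biUnion.1 hv
      obtain ⟨hbB, hbS⟩ := mem_sdiff.1 hb
      obtain ⟨s, hs, hvs⟩ := mem_biUnion.1 (hUeq ▸ mem_biUnion.2 ⟨b, hbB, hvb⟩)
      refine mem_biUnion.2 ⟨s, mem_sdiff.2 ⟨hs, fun hsB => ?_⟩, hvs⟩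
      have hsb : s ≠ b := fun h => hbS (h ▸ hs)
      exact disjoint_left.1 (hdisj hsB hbB hsb) hvs hvb
    rw [union_biUnion, union_eq_left.2 hB',
      hmatch _ (hIdisj.subset (by simp)), card_union_of_disjoint disjoint_sdiff_sdiff] at hF
    have := card_sdiff_add_card_inter S B
    have := card_sdiff_add_card_inter B S
    rw [inter_comm] at this
    omega
  · choose! w hw using fun v (hv : v ∈ S) =>
      exists_private_of_isIrredundant hne hadj hS (v := v) (by simpa using hv)
    simp only [mem_coe] at hw
    have hRS : R ⊆ S := filter_subset _ _
    have hinj : Set.InjOn w R := by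
      intro s hs t ht hst
      have hs := hRS hs
      have ht := hRS ht
      have := (hw s hs s hs).2 rfl
      rw [hst] at this
      exact (hw t ht s hs).1 this
    -- A private neighbor of a member of `R` is not in `S`, as it would have to be that member.
    have hwS : ∀ s ∈ R, w s ∉ S := by
      intro s hs hwS
      have hsS := hRS hs
      have hself : w s = s := (hw s hsS _ hwS).1 (by simpa using (hne _).ne_empty)
      refine (mem_filter.1 hs).2 fun t ht hts => ?_
      by_contra hd
      exact hts ((hw s hsS t ht).1 (by rwa [hself]))
    have hdis : Disjoint R (R.image w) := by
      rw [disjoint_left]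
      intro t ht ht'
      obtain ⟨s, hs, rfl⟩ := mem_image.1 ht'
      exact hwS s hs (hRS ht)
    have hF := hforest (R ∪ R.image w) hRne.inl
    rw [card_union_of_disjoint hdis, card_image_of_injOn hinj] at hF
    have hIF : Disjoint (I.biUnion ends) ((R ∪ R.image w).biUnion ends) := by
      rw [disjoint_biUnion_left]
      intro i hi
      obtain ⟨hiS, hi'⟩ := mem_filter.1 hi
      rw [disjoint_biUnion_right]
      have hiR : ∀ s ∈ R, s ≠ i := by
        rintro s hs rfl
        exact (mem_filter.1 hs).2 hi'
      intro f hf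
      rcases mem_union.1 hf with hf | hf
      · exact hi' f (hRS hf) (hiR f hf)
      · obtain ⟨s, hs, rfl⟩ := mem_image.1 hf
        by_contra hd
        exact hiR s hs ((hw s (hRS hs) i hiS).1 fun h => hd h.symm).symm
    have htot := card_le_card (union_subset (hsub I) (hsub (R ∪ R.image w)))
    rw [card_union_of_disjoint hIF] at htot
    exact ⟨by omega, fun h => by omega⟩

/-! ### Loops and pendant edges -/

/-- The ends of an edge `e` after every loop at `x` has been replaced by an edge from `x` to a new
vertex: `Sum.inl x` is the old vertex `x`, and `Sum.inr x` is the new one. -/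
noncomputable def pendantEnds {X : Type*} (e : Sym2 X) : Finset (X ⊕ X) :=
  open Classical in e.toFinset.disjSum (if e.IsDiag then e.toFinset else ∅)

theorem inl_mem_pendantEnds {X : Type*} {e : Sym2 X} {x : X} :
    Sum.inl x ∈ pendantEnds e ↔ x ∈ e := by
  simp [pendantEnds]

theorem inr_mem_pendantEnds {X : Type*} {e : Sym2 X} {x : X} :
    Sum.inr x ∈ pendantEnds e ↔ e.IsDiag ∧ x ∈ e := by
  simp only [pendantEnds, Finset.inr_mem_disjSum]
  split_ifs with h <;> simp [h]

theorem card_pendantEnds {X : Type*} (e : Sym2 X) : (pendantEnds e).card = 2 := by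
  classical
  rw [pendantEnds, Finset.card_disjSum]
  split_ifs with h
  · rw [Sym2.card_toFinset_of_isDiag _ h]
  · rw [Sym2.card_toFinset_of_not_isDiag _ h, Finset.card_empty]

theorem not_disjoint_pendantEnds {X : Type*} {e f : Sym2 X} :
    ¬ Disjoint (pendantEnds e) (pendantEnds f) ↔ ∃ x, x ∈ e ∧ x ∈ f := by
  rw [Finset.not_disjoint_iff]
  constructor
  · rintro ⟨x | x, he, hf⟩
    · exact ⟨x, inl_mem_pendantEnds.1 he, inl_mem_pendantEnds.1 hf⟩
    · exact ⟨x, (inr_mem_pendantEnds.1 he).2, (inr_mem_pendantEnds.1 hf).2⟩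
  · rintro ⟨x, he, hf⟩
    exact ⟨Sum.inl x, inl_mem_pendantEnds.2 he, inl_mem_pendantEnds.2 hf⟩

open Finset in
/-- Replacing the loops of a forest with loops by pendant edges gives a forest. -/
theorem card_lt_card_biUnion_pendantEnds {X : Type*} [DecidableEq X] {H : SimpleGraph X}
    (hH : H.IsAcyclic) {F : Finset (Sym2 X)} (hF : ∀ e ∈ F, ¬ e.IsDiag → e ∈ H.edgeSet)
    (hne : F.Nonempty) : #F < #(F.biUnion pendantEnds) := by
  classical
  have hsplit := card_filter_add_card_filter_not (s := F) (fun e : Sym2 X => e.IsDiag)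
  have hU : (F.biUnion Sym2.toFinset).Nonempty := by
    obtain ⟨e, he⟩ := hne
    exact ⟨_, mem_biUnion.2 ⟨e, he, Sym2.mem_toFinset.2 (Sym2.out_fst_mem e)⟩⟩
  have hnd : #(F.filter fun e => ¬ e.IsDiag) < #(F.biUnion Sym2.toFinset) :=
    card_lt_card_of_isAcyclic hH _ (fun e he => hF e (mem_filter.1 he).1 (mem_filter.1 he).2) _ hU
      fun e he => subset_biUnion_of_mem Sym2.toFinset (mem_filter.1 he).1
  have hd : #(F.filter fun e => e.IsDiag) = #((F.filter fun e => e.IsDiag).biUnion Sym2.toFinset) := by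
    rw [card_biUnion, sum_congr rfl fun e he =>
      Sym2.card_toFinset_of_isDiag e (mem_filter.1 he).2, card_eq_sum_ones]
    intro e he f hf hef
    refine disjoint_left.2 fun x => ?_
    intro hx hx'
    rw [Sym2.mem_toFinset] at hx hx'
    have he := (mem_filter.1 he).2
    have hf := (mem_filter.1 hf).2
    induction e with | _ a b
    induction f with | _ c d
    simp only [Sym2.mk_isDiag_iff] at he hf
    subst he hf
    simp only [Sym2.mem_iff, or_self] at hx hx'
    exact hef (by rw [← hx, ← hx'])
  have htot : F.biUnion pendantEnds =
      (F.biUnion Sym2.toFinset).disjSum ((F.filter fun e => e.IsDiag).biUnion Sym2.toFinset) := by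
    ext (x | x)
    · simp [inl_mem_pendantEnds]
    · simp [inr_mem_pendantEnds, and_assoc]
  rw [htot, card_disjSum]
  omega

/-! ### Line graphs of forests with loops -/

/-- `G` is the line graph of a forest with loops that has a perfect matching. The map `φ` sends a
vertex of `G` to its edge of the forest, which may be a loop; the non-loops form an acyclic graph.
The set `B` is a perfect matching: the ends of its members partition the covered vertices, and every
loop is a member. (A loop stands for a pendant edge, so it must be matched.) With each
loop replaced by a pendant edge, the forest covers `2 * B.ncard` vertices, so `card_B` says that it is
a tree. -/
structure IsMatchedForestModel {E X : Type*} (G : SimpleGraph E) (φ : E → Sym2 X) (B : Set E) :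
    Prop where
  injective : Function.Injective φ
  adj_iff : ∀ e f, G.Adj e f ↔ e ≠ f ∧ ∃ x, x ∈ φ e ∧ x ∈ φ f
  isAcyclic : (SimpleGraph.fromEdgeSet (Set.range φ)).IsAcyclic
  mem_of_isDiag : ∀ e, (φ e).IsDiag → e ∈ B
  eq_of_mem : ∀ b ∈ B, ∀ c ∈ B, ∀ x, x ∈ φ b → x ∈ φ c → b = c
  exists_mem : ∀ e, ∀ x ∈ φ e, ∃ b ∈ B, x ∈ φ b
  card_B : 2 * B.ncard = Nat.card E + 1

namespace IsMatchedForestModel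

variable {E X : Type*} {G : SimpleGraph E} {φ : E → Sym2 X} {B : Set E}

theorem comap_iso {E' : Type*} {G' : SimpleGraph E'} (h : IsMatchedForestModel G φ B)
    (i : G' ≃g G) : IsMatchedForestModel G' (φ ∘ i) (i ⁻¹' B) where
  injective := h.injective.comp i.injective
  adj_iff e f := by
    rw [← i.map_adj_iff, h.adj_iff, i.injective.ne_iff]; rfl
  isAcyclic := by
    rw [Set.range_comp, i.surjective.range_eq, Set.image_univ]
    exact h.isAcyclic
  mem_of_isDiag e := h.mem_of_isDiag (i e)
  eq_of_mem b hb c hc x hx hx' := i.injective (h.eq_of_mem _ hb _ hc x hx hx')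
  exists_mem e x hx := by
    obtain ⟨b, hb, hxb⟩ := h.exists_mem (i e) x hx
    exact ⟨i.symm b, by simpa using hb, by simpa using hxb⟩
  card_B := by
    rw [Set.ncard_preimage_of_injective_subset_range i.injective (by simp [i.surjective.range_eq]),
      h.card_B, Nat.card_congr i.toEquiv]

theorem isIndepSet (h : IsMatchedForestModel G φ B) : G.IsIndepSet B := by
  intro b hb c hc hbc hadj
  obtain ⟨-, x, hx, hx'⟩ := (h.adj_iff b c).1 hadj
  exact hbc (h.eq_of_mem b hb c hc x hx hx')

theorem ncard_neighborSet_inter (h : IsMatchedForestModel G φ B) {a : E} (ha : a ∉ B) :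
    (G.neighborSet a ∩ B).ncard = 2 := by
  obtain ⟨x, y, hxy⟩ : ∃ x y, φ a = s(x, y) := by
    induction hφ : φ a with | _ x y
    exact ⟨x, y, rfl⟩
  have hne : x ≠ y := by
    rintro rfl
    exact ha (h.mem_of_isDiag a (by simp [hxy]))
  obtain ⟨b, hb, hxb⟩ := h.exists_mem a x (by simp [hxy])
  obtain ⟨c, hc, hyc⟩ := h.exists_mem a y (by simp [hxy])
  have hbc : b ≠ c := by
    rintro rfl
    exact ha (h.injective (hxy.trans ((Sym2.mem_and_mem_iff hne).1 ⟨hxb, hyc⟩).symm) ▸ hb)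
  rw [Set.ncard_eq_two]
  refine ⟨b, c, hbc, Set.ext fun d => ?_⟩
  simp only [Set.mem_inter_iff, SimpleGraph.mem_neighborSet, h.adj_iff, hxy, Sym2.mem_iff,
    Set.mem_insert_iff, Set.mem_singleton_iff]
  constructor
  · rintro ⟨⟨-, z, rfl | rfl, hz⟩, hd⟩
    · exact Or.inl (h.eq_of_mem d hd b hb _ hz hxb)
    · exact Or.inr (h.eq_of_mem d hd c hc _ hz hyc)
  · rintro (rfl | rfl)
    · exact ⟨⟨fun e => ha (e ▸ hb), x, Or.inl rfl, hxb⟩, hb⟩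
    · exact ⟨⟨fun e => ha (e ▸ hc), y, Or.inr rfl, hyc⟩, hc⟩

theorem isAssociatedPartition [Finite E] (h : IsMatchedForestModel G φ B) :
    IsAssociatedPartition G Bᶜ B where
  disjoint := disjoint_compl_left
  union_eq := Set.compl_union_self B
  card_A := by
    have := Set.ncard_add_ncard_compl B
    have := h.card_B
    omega
  card_B := h.card_B
  indep := h.isIndepSet
  two_neighbors _ ha := h.ncard_neighborSet_inter ha

theorem ncard_le_and_eq [Finite E] (h : IsMatchedForestModel G φ B) {S : Set E}
    (hS : IsIrredundant G S) : S.ncard ≤ B.ncard ∧ (S.ncard = B.ncard → S = B) := by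
  classical
  have := Fintype.ofFinite E
  have key := card_le_and_eq_of_isIrredundant (G := G) (ends := fun e => pendantEnds (φ e))
    (fun e => card_pendantEnds _)
    (fun e f => by rw [h.adj_iff, not_disjoint_pendantEnds])
    (fun F hF => by
      have := card_lt_card_biUnion_pendantEnds h.isAcyclic (F := F.image φ)
        (fun e he hd => by
          obtain ⟨g, -, rfl⟩ := Finset.mem_image.1 he
          rw [SimpleGraph.edgeSet_fromEdgeSet]
          exact ⟨⟨g, rfl⟩, hd⟩) (hF.image φ)
      rwa [Finset.card_image_of_injective _ h.injective, Finset.image_biUnion] at this)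
    (B := B.toFinset) (S := S.toFinset)
    (by
      intro b hb c hc hbc
      by_contra hd
      obtain ⟨x, hx, hx'⟩ := not_disjoint_pendantEnds.1 hd
      exact hbc (h.eq_of_mem b (by simpa using hb) c (by simpa using hc) x hx hx'))
    (by
      rintro e (x | x) hx
      · obtain ⟨b, hb, hxb⟩ := h.exists_mem e x (inl_mem_pendantEnds.1 hx)
        exact Finset.mem_biUnion.2 ⟨b, by simpa using hb, inl_mem_pendantEnds.2 hxb⟩
      · have hd := (inr_mem_pendantEnds.1 hx).1
        exact Finset.mem_biUnion.2 ⟨e, by simpa using h.mem_of_isDiag e hd, hx⟩)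
    (by simpa using hS)
  simpa only [← Set.ncard_eq_toFinset_card', Set.toFinset_inj] using key

end IsMatchedForestModel

theorem isIrredundant_of_isIndepSet {V : Type u} {G : SimpleGraph V} {S : Set V}
    (hS : G.IsIndepSet S) : IsIrredundant G S := by
  intro v hv
  refine ⟨v, Set.ext fun w => ?_⟩
  simp only [closedNeighborSet, Set.mem_inter_iff, Set.mem_insert_iff, SimpleGraph.mem_neighborSet,
    Set.mem_singleton_iff]
  constructor
  · rintro ⟨rfl | hadj, hw⟩
    · rfl
    · exact absurd hadj (hS hv hw hadj.ne)
  · rintro rfl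
    exact ⟨Or.inl rfl, hv⟩

theorem IsMatchedForestModel.isIRSet_iff {V : Type u} [Finite V] {X : Type*} {G : SimpleGraph V}
    {φ : V → Sym2 X} {B : Set V} (h : IsMatchedForestModel G φ B) {Q : Set V} :
    IsIRSet G Q ↔ Q = B := by
  have hB := isIrredundant_of_isIndepSet h.isIndepSet
  have hIR : upperIrredundance G = B.ncard := by
    refine IsGreatest.csSup_eq ⟨⟨B, hB, rfl⟩, ?_⟩
    rintro k ⟨S, hS, rfl⟩
    exact (h.ncard_le_and_eq hS).1
  constructor
  · rintro ⟨hQ, hcard⟩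
    exact (h.ncard_le_and_eq hQ).2 (hcard.trans hIR)
  · rintro rfl
    exact ⟨hB, hIR.symm⟩

/-- An associated partition has an independent second part, which is therefore irredundant, and its
size is that of the perfect matching `B`; so it is `B`. -/
theorem IsMatchedForestModel.eq_of_isAssociatedPartition {V : Type u} [Finite V] {X : Type*}
    {G : SimpleGraph V} {φ : V → Sym2 X} {B : Set V} (h : IsMatchedForestModel G φ B)
    {A' B' : Set V} (h' : IsAssociatedPartition G A' B') : B' = B := by
  refine (h.ncard_le_and_eq (isIrredundant_of_isIndepSet h'.indep)).2 ?_
  have := h'.card_B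
  have := h.card_B
  omega

/-! ### Edges of a corona -/

section Corona

variable {W : Type*} {T : SimpleGraph W}

/-- The edge of the corona that joins `w` to its new leaf. -/
def coronaLeafEdge (T : SimpleGraph W) (w : W) : (corona T).edgeSet :=
  ⟨s(Sum.inl w, Sum.inr w), (rfl : w = w)⟩

/-- An edge of `T`, as an edge of the corona. -/
def coronaOldEdge {u v : W} (h : T.Adj u v) : (corona T).edgeSet :=
  ⟨s(Sum.inl u, Sum.inl v), h⟩

theorem eq_coronaLeafEdge_or_eq_coronaOldEdge (e : (corona T).edgeSet) :
    (∃ w, e = coronaLeafEdge T w) ∨ ∃ u v, ∃ h : T.Adj u v, e = coronaOldEdge h := by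
  obtain ⟨e, he⟩ := e
  induction e with | _ a b
  rcases a with a | a <;> rcases b with b | b
  · exact Or.inr ⟨a, b, he, rfl⟩
  · obtain rfl : a = b := he
    exact Or.inl ⟨a, rfl⟩
  · obtain rfl : a = b := he
    exact Or.inl ⟨a, Subtype.ext Sym2.eq_swap⟩
  · exact False.elim he

/-- In the line graph of a corona, an old edge `uv` is adjacent to the leaf edges at `u` and at `v`,
which are not adjacent to each other. -/
theorem exists_eq_coronaLeafEdge_of_isSimplicial {e : (corona T).edgeSet}
    (he : IsSimplicial (corona T).lineGraph e) : ∃ w, e = coronaLeafEdge T w := by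
  rcases eq_coronaLeafEdge_or_eq_coronaOldEdge e with h | ⟨u, v, huv, rfl⟩
  · exact h
  have hne := huv.ne
  have hu : coronaLeafEdge T u ∈ (corona T).lineGraph.neighborSet (coronaOldEdge huv) := by
    rw [SimpleGraph.mem_neighborSet, SimpleGraph.lineGraph_adj_iff_exists]
    exact ⟨fun h => by simpa [coronaLeafEdge, coronaOldEdge] using congrArg Subtype.val h, Sum.inl u, by
      simp [coronaLeafEdge, coronaOldEdge]⟩
  have hv : coronaLeafEdge T v ∈ (corona T).lineGraph.neighborSet (coronaOldEdge huv) := by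
    rw [SimpleGraph.mem_neighborSet, SimpleGraph.lineGraph_adj_iff_exists]
    exact ⟨fun h => by simpa [coronaLeafEdge, coronaOldEdge] using congrArg Subtype.val h, Sum.inl v, by
      simp [coronaLeafEdge, coronaOldEdge]⟩
  have hadj := he hu hv fun h => by
    simpa [coronaLeafEdge, hne] using congrArg Subtype.val h
  rw [SimpleGraph.lineGraph_adj_iff_exists] at hadj
  simp [coronaLeafEdge, hne] at hadj

end Corona

/-! ### The forest of a construction -/

namespace Construction

variable (D : Construction)

/-- The vertices of the trees of the construction. -/
abbrev Node : Type := Σ i, D.W i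

/-- The leaf edge at a tree vertex, as a vertex of the disjoint union of the line graphs. -/
def leaf (x : D.Node) : Σ i, (corona (D.T i)).edgeSet :=
  ⟨x.1, coronaLeafEdge (D.T x.1) x.2⟩

theorem exists_x_eq_leaf (k : Fin (D.q - 1)) : ∃ a : D.Node, D.x k = D.leaf a := by
  obtain ⟨w, hw⟩ := exists_eq_coronaLeafEdge_of_isSimplicial (D.x_simplicial k)
  exact ⟨⟨_, w⟩, Sigma.ext rfl (heq_of_eq hw)⟩

theorem exists_y_eq_leaf (k : Fin (D.q - 1)) : ∃ a : D.Node, D.y k = D.leaf a := by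
  obtain ⟨w, hw⟩ := exists_eq_coronaLeafEdge_of_isSimplicial (D.y_simplicial k)
  exact ⟨⟨_, w⟩, Sigma.ext rfl (heq_of_eq hw)⟩

/-- The tree vertex whose leaf edge is the first member of the `k`-th pair. -/
noncomputable def left (k : Fin (D.q - 1)) : D.Node := (D.exists_x_eq_leaf k).choose

/-- The tree vertex whose leaf edge is the second member of the `k`-th pair. -/
noncomputable def right (k : Fin (D.q - 1)) : D.Node := (D.exists_y_eq_leaf k).choose

theorem leaf_left (k : Fin (D.q - 1)) : D.leaf (D.left k) = D.x k :=
  (D.exists_x_eq_leaf k).choose_spec.symm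

theorem leaf_right (k : Fin (D.q - 1)) : D.leaf (D.right k) = D.y k :=
  (D.exists_y_eq_leaf k).choose_spec.symm

theorem left_injective : Function.Injective D.left := by
  intro k l h
  have : D.x k = D.x l := by rw [← leaf_left, ← leaf_left, h]
  exact Sum.inl_injective (D.all_distinct (a₁ := Sum.inl k) (a₂ := Sum.inl l) this)

theorem right_injective : Function.Injective D.right := by
  intro k l h
  have : D.y k = D.y l := by rw [← leaf_right, ← leaf_right, h]
  exact Sum.inr_injective (D.all_distinct (a₁ := Sum.inr k) (a₂ := Sum.inr l) this)

theorem left_ne_right (k l : Fin (D.q - 1)) : D.left k ≠ D.right l := by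
  intro h
  have : D.x k = D.y l := by rw [← leaf_left, ← leaf_right, h]
  exact Sum.inl_ne_inr (D.all_distinct (a₁ := Sum.inl k) (a₂ := Sum.inr l) this)

theorem left_fst_ne_right_fst (k : Fin (D.q - 1)) : (D.left k).1 ≠ (D.right k).1 := by
  have h := D.x_ne_y_component k
  rwa [← leaf_left, ← leaf_right] at h

open Classical in
/-- The tree vertex whose leaf edge is contracted with the leaf edge at `x`; it is `x` itself if the
leaf edge at `x` is in none of the pairs. -/
noncomputable def mate (x : D.Node) : D.Node :=
  if h : ∃ k, D.left k = x then D.right h.choose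
  else if h : ∃ k, D.right k = x then D.left h.choose
  else x

theorem mate_left (k : Fin (D.q - 1)) : D.mate (D.left k) = D.right k := by
  have h : ∃ l, D.left l = D.left k := ⟨k, rfl⟩
  rw [mate, dif_pos h, D.left_injective h.choose_spec]

theorem mate_right (k : Fin (D.q - 1)) : D.mate (D.right k) = D.left k := by
  have h : ∃ l, D.right l = D.right k := ⟨k, rfl⟩
  rw [mate, dif_neg (fun ⟨l, hl⟩ => D.left_ne_right l k hl), dif_pos h,
    D.right_injective h.choose_spec]

theorem eq_left_or_eq_right_or_mate_eq (x : D.Node) :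
    (∃ k, x = D.left k) ∨ (∃ k, x = D.right k) ∨ D.mate x = x := by
  by_cases h : ∃ k, D.left k = x
  · exact Or.inl (h.imp fun _ => Eq.symm)
  by_cases h' : ∃ k, D.right k = x
  · exact Or.inr (Or.inl (h'.imp fun _ => Eq.symm))
  · exact Or.inr (Or.inr (by rw [mate, dif_neg h, dif_neg h']))

theorem mate_mate (x : D.Node) : D.mate (D.mate x) = x := by
  rcases D.eq_left_or_eq_right_or_mate_eq x with ⟨k, rfl⟩ | ⟨k, rfl⟩ | h
  · rw [mate_left, mate_right]
  · rw [mate_right, mate_left]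
  · rw [h, h]

theorem mate_eq_of_fst_eq {x : D.Node} (hx : (D.mate x).1 = x.1) : D.mate x = x := by
  rcases D.eq_left_or_eq_right_or_mate_eq x with ⟨k, rfl⟩ | ⟨k, rfl⟩ | h
  · rw [mate_left] at hx
    exact absurd hx.symm (D.left_fst_ne_right_fst k)
  · rw [mate_right] at hx
    exact absurd hx (D.left_fst_ne_right_fst k)
  · exact h

/-- The vertex of the contracted graph that comes from the leaf edge at `x`. -/
def leafClass (x : D.Node) : ContractedVertex D.x D.y := Quot.mk _ (D.leaf x)

theorem leafClass_left (k : Fin (D.q - 1)) : D.leafClass (D.left k) = D.leafClass (D.right k) :=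
  Quot.sound ⟨k, D.leaf_left k, D.leaf_right k⟩

theorem leafClass_mate (x : D.Node) : D.leafClass (D.mate x) = D.leafClass x := by
  rcases D.eq_left_or_eq_right_or_mate_eq x with ⟨k, rfl⟩ | ⟨k, rfl⟩ | h
  · rw [mate_left, leafClass_left]
  · rw [mate_right, leafClass_left]
  · rw [h]

/-- The tree vertex represented by a vertex of the `i`-th corona: a leaf represents the mate of the
vertex it is attached to. -/
noncomputable def node (i : Fin D.q) : D.W i ⊕ D.W i → D.Node
  | Sum.inl w => ⟨i, w⟩
  | Sum.inr w => D.mate ⟨i, w⟩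

/-- The edge of the forest that represents a vertex of the contracted graph. An edge of a tree
represents itself, and the leaf edge at `x` is represented by the edge from `x` to its mate, which
is a loop if this leaf edge is not contracted. -/
noncomputable def edge : ContractedVertex D.x D.y → Sym2 D.Node :=
  Quot.lift (fun e => e.2.1.map (D.node e.1)) (by
    rintro _ _ ⟨k, rfl, rfl⟩
    rw [← leaf_left, ← leaf_right]
    change s(D.left k, D.mate (D.left k)) = s(D.right k, D.mate (D.right k))
    rw [mate_left, mate_right, Sym2.eq_swap])

theorem edge_leafClass (x : D.Node) : D.edge (D.leafClass x) = s(x, D.mate x) := rfl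

/-- The vertex of the contracted graph that comes from an edge of a tree. -/
def oldClass {i : Fin D.q} {u v : D.W i} (h : (D.T i).Adj u v) : ContractedVertex D.x D.y :=
  Quot.mk _ ⟨i, coronaOldEdge h⟩

theorem edge_oldClass {i : Fin D.q} {u v : D.W i} (h : (D.T i).Adj u v) :
    D.edge (D.oldClass h) = s(⟨i, u⟩, ⟨i, v⟩) := rfl

theorem exists_eq_leafClass_or_exists_eq_oldClass (g : ContractedVertex D.x D.y) :
    (∃ x, g = D.leafClass x) ∨ ∃ (i : Fin D.q) (u v : D.W i) (h : (D.T i).Adj u v),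
      g = D.oldClass h := by
  induction g using Quot.ind with | _ e
  obtain ⟨i, e⟩ := e
  rcases eq_coronaLeafEdge_or_eq_coronaOldEdge e with ⟨w, rfl⟩ | ⟨u, v, h, rfl⟩
  · exact Or.inl ⟨⟨i, w⟩, rfl⟩
  · exact Or.inr ⟨i, u, v, h, rfl⟩

theorem leafClass_eq_of_mem {x y : D.Node} (h : x ∈ D.edge (D.leafClass y)) :
    D.leafClass y = D.leafClass x := by
  rw [edge_leafClass, Sym2.mem_iff] at h
  rcases h with rfl | rfl
  · rfl
  · rw [leafClass_mate]

theorem mem_edge_leafClass (x : D.Node) : x ∈ D.edge (D.leafClass x) := by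
  simp [edge_leafClass]

/-- A leaf edge leads to its mate, outside the tree, or is a loop; so it differs from the edges of
the trees. -/
theorem edge_leafClass_ne_edge_oldClass (x : D.Node) {i : Fin D.q} {u v : D.W i}
    (h : (D.T i).Adj u v) : D.edge (D.leafClass x) ≠ D.edge (D.oldClass h) := by
  rw [edge_leafClass, edge_oldClass]
  intro he
  have hfst : (D.mate x).1 = x.1 := by
    rcases Sym2.eq_iff.1 he with ⟨h1, h2⟩ | ⟨h1, h2⟩ <;>
      exact (congrArg Sigma.fst h2).trans (congrArg Sigma.fst h1).symm
  rw [D.mate_eq_of_fst_eq hfst] at he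
  have : (⟨i, u⟩ : D.Node) = ⟨i, v⟩ := by
    rcases Sym2.eq_iff.1 he with ⟨h1, h2⟩ | ⟨h1, h2⟩ <;> rw [← h1, ← h2]
  exact h.ne (by simpa using this)

theorem edge_injective : Function.Injective D.edge := by
  intro g g' he
  rcases D.exists_eq_leafClass_or_exists_eq_oldClass g with ⟨x, rfl⟩ | ⟨i, u, v, h, rfl⟩ <;>
    rcases D.exists_eq_leafClass_or_exists_eq_oldClass g' with ⟨y, rfl⟩ | ⟨j, u', v', h', rfl⟩
  · exact (D.leafClass_eq_of_mem (he ▸ D.mem_edge_leafClass x)).symm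
  · exact absurd he (D.edge_leafClass_ne_edge_oldClass x h')
  · exact absurd he.symm (D.edge_leafClass_ne_edge_oldClass y h)
  · rw [edge_oldClass, edge_oldClass] at he
    obtain rfl : i = j := by
      rcases Sym2.eq_iff.1 he with ⟨h1, -⟩ | ⟨h1, -⟩ <;> exact congrArg Sigma.fst h1
    rcases Sym2.eq_iff.1 he with ⟨h1, h2⟩ | ⟨h1, h2⟩
    · obtain rfl : u = u' := by simpa using h1
      obtain rfl : v = v' := by simpa using h2
      rfl
    · obtain rfl : u = v' := by simpa using h1
      obtain rfl : v = u' := by simpa using h2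
      exact congrArg (fun e => Quot.mk _ (⟨i, e⟩ : Σ i, (corona (D.T i)).edgeSet))
        (Subtype.ext Sym2.eq_swap)

/-- A vertex of the contracted graph whose edge contains `x` has a representative that contains `x`
as an old vertex of the corona. -/
theorem exists_rep_of_mem_edge {g : ContractedVertex D.x D.y} {x : D.Node} (hx : x ∈ D.edge g) :
    ∃ e : (corona (D.T x.1)).edgeSet, g = Quot.mk _ ⟨x.1, e⟩ ∧ Sum.inl x.2 ∈ e.1 := by
  rcases D.exists_eq_leafClass_or_exists_eq_oldClass g with ⟨y, rfl⟩ | ⟨i, u, v, h, rfl⟩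
  · exact ⟨coronaLeafEdge (D.T x.1) x.2, D.leafClass_eq_of_mem hx, by simp [coronaLeafEdge]⟩
  · rw [edge_oldClass, Sym2.mem_iff] at hx
    rcases hx with rfl | rfl
    · exact ⟨coronaOldEdge h, rfl, by simp [coronaOldEdge]⟩
    · exact ⟨coronaOldEdge h, rfl, by simp [coronaOldEdge]⟩

theorem graph_adj_iff (g g' : ContractedVertex D.x D.y) :
    D.graph.Adj g g' ↔ g ≠ g' ∧ ∃ x, x ∈ D.edge g ∧ x ∈ D.edge g' := by
  rw [graph, contractPairs, SimpleGraph.map_adj']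
  constructor
  · rintro ⟨hne, _, _, ⟨i, e, e', hadj, rfl, rfl⟩, rfl, rfl⟩
    obtain ⟨-, a, ha, ha'⟩ := SimpleGraph.lineGraph_adj_iff_exists.1 hadj
    exact ⟨hne, D.node i a, Sym2.mem_map.2 ⟨a, ha, rfl⟩, Sym2.mem_map.2 ⟨a, ha', rfl⟩⟩
  · rintro ⟨hne, x, hx, hx'⟩
    obtain ⟨e, rfl, he⟩ := D.exists_rep_of_mem_edge hx
    obtain ⟨e', rfl, he'⟩ := D.exists_rep_of_mem_edge hx'
    refine ⟨hne, _, _, ⟨x.1, e, e', ?_, rfl, rfl⟩, rfl, rfl⟩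
    exact SimpleGraph.lineGraph_adj_iff_exists.2 ⟨fun h => hne (h ▸ rfl), _, he, he'⟩

/-! ### Acyclicity of the forest -/

/-- The forest of the construction: the trees, joined by an edge for each contracted pair. -/
def forest : SimpleGraph D.Node := SimpleGraph.fromEdgeSet (Set.range D.edge)

theorem exists_adj {i : Fin D.q} (u : D.W i) : ∃ v, (D.T i).Adj u v := by
  have := D.nontrivial i
  exact (D.isTree i).connected.preconnected.exists_adj_of_nontrivial u

theorem maximal_isClique_star (x : D.Node) : Maximal D.graph.IsClique {g | x ∈ D.edge g} := by
  refine ⟨fun g hg g' hg' hne => (D.graph_adj_iff g g').2 ⟨hne, x, hg, hg'⟩, ?_⟩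
  intro Q hQ hsub g hg
  obtain ⟨y, hy⟩ := D.exists_adj x.2
  have hp : D.leafClass x ∈ Q := hsub (D.mem_edge_leafClass x)
  have ht : D.oldClass hy ∈ Q := hsub (by simp [edge_oldClass])
  change x ∈ D.edge g
  by_contra hx
  -- A vertex of `Q` outside the star would be the edge from `y` to the mate of `x`.
  have hmem : ∀ g' ∈ Q, x ∈ D.edge g' → ∃ z, z ∈ D.edge g ∧ z ∈ D.edge g' := fun g' hg' hxg' =>
    ((D.graph_adj_iff g g').1 (hQ hg hg' fun h => hx (h ▸ hxg'))).2
  obtain ⟨z, hz, hz'⟩ := hmem _ hp (D.mem_edge_leafClass x)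
  obtain ⟨z', hz1, hz1'⟩ := hmem _ ht (by simp [edge_oldClass])
  rw [edge_leafClass, Sym2.mem_iff] at hz'
  rw [edge_oldClass, Sym2.mem_iff] at hz1'
  have hzm : z = D.mate x := hz'.resolve_left fun h => hx (h ▸ hz)
  have hzy : z' = ⟨x.1, y⟩ := hz1'.resolve_left fun h => hx (by rwa [h] at hz1)
  have hfst : (D.mate x).1 ≠ x.1 := fun h => hx (by
    rw [D.mate_eq_of_fst_eq h] at hzm
    rwa [← hzm])
  have hyx : (⟨x.1, y⟩ : D.Node) ≠ x := fun h => hy.ne' (by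
    have := Sigma.ext_iff.1 h
    simpa using this)
  have hge : D.edge g = s(D.mate x, ⟨x.1, y⟩) := by
    subst hzm hzy
    exact (Sym2.mem_and_mem_iff fun h => hfst (by rw [h])).1 ⟨hz, hz1⟩
  rcases D.exists_eq_leafClass_or_exists_eq_oldClass g with ⟨w, rfl⟩ | ⟨i, u, v, h, rfl⟩
  · rw [edge_leafClass] at hge
    rcases Sym2.eq_iff.1 hge with ⟨h1, h2⟩ | ⟨h1, h2⟩
    · rw [h1, mate_mate] at h2
      exact hyx h2.symm
    · rw [h1] at h2
      exact hyx (by rw [← D.mate_mate ⟨x.1, y⟩, h2, mate_mate])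
  · rw [edge_oldClass] at hge
    refine hfst ?_
    rcases Sym2.eq_iff.1 hge with ⟨h1, h2⟩ | ⟨h1, h2⟩ <;>
      rw [← congrArg Sigma.fst h1, ← congrArg Sigma.fst h2]

theorem star_injective :
    Function.Injective fun x : D.Node => {g | x ∈ D.edge g} := by
  intro x y h
  by_contra hne
  obtain ⟨z, hz⟩ := D.exists_adj x.2
  have h1 : y ∈ D.edge (D.oldClass hz) := by
    have : D.oldClass hz ∈ {g | x ∈ D.edge g} := by simp [edge_oldClass]
    exact (Set.ext_iff.1 h _).1 this
  have h2 : y ∈ D.edge (D.leafClass x) := (Set.ext_iff.1 h _).1 (D.mem_edge_leafClass x)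
  rw [edge_oldClass, Sym2.mem_iff] at h1
  rw [edge_leafClass, Sym2.mem_iff] at h2
  have h2 := h2.resolve_left (Ne.symm hne)
  have hfst : y.1 = x.1 := by rcases h1 with rfl | rfl <;> rfl
  rw [h2] at hfst
  exact hne (h2.trans (D.mate_eq_of_fst_eq hfst)).symm

/-- If some pair is contracted, the forest embeds into the clique graph by sending a tree vertex
to the clique of the edges at it. -/
theorem isAcyclic_forest_of_two_le (hq : 2 ≤ D.q) : D.forest.IsAcyclic := by
  refine SimpleGraph.IsAcyclic.comap (G' := cliqueGraph D.graph)
    ⟨fun x => ⟨_, D.maximal_isClique_star x⟩, ?_⟩ ?_ (D.cliqueGraph_isTree hq).isAcyclic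
  · rintro x y ⟨⟨g, hg⟩, hne⟩
    refine ⟨fun h => hne (D.star_injective (congrArg Subtype.val h)), g, ?_, ?_⟩
    · change x ∈ D.edge g
      simp [hg]
    · change y ∈ D.edge g
      simp [hg]
  · exact fun x y h => D.star_injective (congrArg Subtype.val h)

/-- If there is only one tree, then the forest is that tree. -/
theorem isAcyclic_forest_of_eq_one (hq : D.q = 1) : D.forest.IsAcyclic := by
  have hsub : Subsingleton (Fin D.q) := by rw [hq]; infer_instance
  have hfst : ∀ i j : Fin D.q, i = j := fun i j => Subsingleton.elim i j
  let i₀ : Fin D.q := ⟨0, by omega⟩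
  have hsurj : ∀ x : D.Node, ∃ w : D.W i₀, x = ⟨i₀, w⟩ := by
    rintro ⟨i, w⟩
    obtain rfl := hfst i i₀
    exact ⟨w, rfl⟩
  choose f hf using hsurj
  refine SimpleGraph.IsAcyclic.comap (G' := D.T i₀) ⟨f, ?_⟩ ?_ (D.isTree i₀).isAcyclic
  · rintro x y ⟨⟨g, hg⟩, hne⟩
    rcases D.exists_eq_leafClass_or_exists_eq_oldClass g with ⟨z, rfl⟩ | ⟨i, u, v, h, rfl⟩
    · rw [edge_leafClass, D.mate_eq_of_fst_eq (hfst _ _)] at hg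
      rcases Sym2.eq_iff.1 hg with ⟨h1, h2⟩ | ⟨h1, h2⟩ <;> exact absurd (h1.symm.trans h2) (by tauto)
    · obtain rfl := hfst i i₀
      rw [edge_oldClass, hf x, hf y] at hg
      have : s(u, v) = s(f x, f y) :=
        Sym2.map.injective (f := fun w : D.W i₀ => (⟨i₀, w⟩ : D.Node)) sigma_mk_injective hg
      rw [← SimpleGraph.mem_edgeSet, ← this]
      exact h
  · intro x y h
    rw [hf x, hf y]
    exact congrArg _ h

theorem isAcyclic_forest : D.forest.IsAcyclic := by
  rcases D.one_le_q.lt_or_eq with h | h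
  · exact D.isAcyclic_forest_of_two_le h
  · exact D.isAcyclic_forest_of_eq_one h.symm

/-! ### The number of vertices -/

instance (i : Fin D.q) : Finite (D.W i) := D.finite i

/-- The vertices of the contracted graph that come from leaf edges: the perfect matching. -/
def leafClasses : Set (ContractedVertex D.x D.y) := Set.range D.leafClass

theorem ncard_leafClasses : D.leafClasses.ncard + (D.q - 1) = Nat.card D.Node := by
  have himage : D.leafClasses = D.leafClass '' (Set.range D.right)ᶜ := by
    refine Set.Subset.antisymm ?_ (Set.image_subset_range _ _)
    rintro _ ⟨x, rfl⟩
    by_cases hx : x ∈ Set.range D.right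
    · obtain ⟨k, rfl⟩ := hx
      exact ⟨D.left k, fun ⟨l, hl⟩ => D.left_ne_right k l hl.symm, D.leafClass_left k⟩
    · exact ⟨x, hx, rfl⟩
  have hinj : Set.InjOn D.leafClass (Set.range D.right)ᶜ := by
    intro x hx y hy h
    have hmem : x ∈ D.edge (D.leafClass y) := h ▸ D.mem_edge_leafClass x
    rw [edge_leafClass, Sym2.mem_iff] at hmem
    rcases hmem with h | h
    · exact h
    rcases D.eq_left_or_eq_right_or_mate_eq y with ⟨k, rfl⟩ | ⟨k, rfl⟩ | hy'
    · exact absurd ⟨k, by rw [h, mate_left]⟩ hx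
    · exact absurd ⟨k, rfl⟩ hy
    · rw [h, hy']
  have hright : (Set.range D.right).ncard = D.q - 1 := by
    rw [← Nat.card_coe_set_eq, Nat.card_range_of_injective D.right_injective, Nat.card_fin]
  rw [himage, hinj.ncard_image]
  have := Set.ncard_add_ncard_compl (Set.range D.right)
  omega

/-- An edge of a tree, as a vertex of the contracted graph. -/
def treeEdgeClass (e : Σ i, (D.T i).edgeSet) : ContractedVertex D.x D.y :=
  Quot.mk _ ⟨e.1, e.2.1.map Sum.inl, by
    obtain ⟨i, e, he⟩ := e
    induction e with | _ u v
    exact he⟩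

theorem edge_treeEdgeClass (e : Σ i, (D.T i).edgeSet) :
    D.edge (D.treeEdgeClass e) = e.2.1.map (Sigma.mk e.1) := by
  obtain ⟨i, e, he⟩ := e
  induction e with | _ u v
  rfl

theorem treeEdgeClass_injective : Function.Injective D.treeEdgeClass := by
  rintro ⟨i, e, he⟩ ⟨j, f, hf⟩ h
  have h := congrArg D.edge h
  rw [edge_treeEdgeClass, edge_treeEdgeClass] at h
  obtain rfl : i = j := by
    induction e with | _ a b
    induction f with | _ c d
    rcases Sym2.eq_iff.1 h with ⟨h1, -⟩ | ⟨h1, -⟩ <;> exact congrArg Sigma.fst h1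
  obtain rfl := Sym2.map.injective sigma_mk_injective h
  rfl

theorem range_treeEdgeClass : Set.range D.treeEdgeClass = D.leafClassesᶜ := by
  ext g
  rcases D.exists_eq_leafClass_or_exists_eq_oldClass g with ⟨x, rfl⟩ | ⟨i, u, v, h, rfl⟩
  · refine iff_of_false ?_ fun hn => hn ⟨x, rfl⟩
    rintro ⟨⟨i, e, he⟩, hx⟩
    induction e with | _ u v
    exact D.edge_leafClass_ne_edge_oldClass x he (congrArg D.edge hx).symm
  · refine iff_of_true ⟨⟨i, s(u, v), h⟩, rfl⟩ ?_
    rintro ⟨x, hx⟩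
    exact D.edge_leafClass_ne_edge_oldClass x h (congrArg D.edge hx)

theorem ncard_compl_leafClasses : D.leafClassesᶜ.ncard + D.q = Nat.card D.Node := by
  have htree : ∀ i, Nat.card (D.T i).edgeSet + 1 = Nat.card (D.W i) := fun i =>
    (SimpleGraph.isTree_iff_connected_and_card.1 (D.isTree i)).2
  rw [← range_treeEdgeClass, ← Nat.card_coe_set_eq,
    Nat.card_range_of_injective D.treeEdgeClass_injective, Nat.card_sigma, Nat.card_sigma,
    ← Finset.sum_congr rfl fun i _ => htree i, Finset.sum_add_distrib]
  simp

theorem isMatchedForestModel : IsMatchedForestModel D.graph D.edge D.leafClasses where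
  injective := D.edge_injective
  adj_iff := D.graph_adj_iff
  isAcyclic := D.isAcyclic_forest
  mem_of_isDiag g hg := by
    rcases D.exists_eq_leafClass_or_exists_eq_oldClass g with ⟨x, rfl⟩ | ⟨i, u, v, h, rfl⟩
    · exact ⟨x, rfl⟩
    · rw [edge_oldClass, Sym2.mk_isDiag_iff] at hg
      exact absurd (by simpa using hg) h.ne
  eq_of_mem := by
    rintro _ ⟨y, rfl⟩ _ ⟨z, rfl⟩ x hy hz
    rw [D.leafClass_eq_of_mem hy, D.leafClass_eq_of_mem hz]
  exists_mem _ x _ := ⟨_, ⟨x, rfl⟩, D.mem_edge_leafClass x⟩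
  card_B := by
    have h1 := D.ncard_leafClasses
    have h2 := D.ncard_compl_leafClasses
    have h3 := Set.ncard_add_ncard_compl D.leafClasses
    have := D.one_le_q
    omega

end Construction

end Favaron

theorem lemma5p5 {V : Type*} [Finite V] (G : SimpleGraph V) (hG : Favaron.InFamily G) :
    (∃ A B : Set V, Favaron.IsAssociatedPartition G A B) ∧
      ∀ A B : Set V, Favaron.IsAssociatedPartition G A B →
        ∀ Q : Set V, Favaron.IsIRSet G Q ↔ Q = B := by
  obtain ⟨D, ⟨i⟩⟩ := hG
  have h := D.isMatchedForestModel.comap_iso i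
  refine ⟨⟨_, _, h.isAssociatedPartition⟩, fun A B hAB Q => ?_⟩
  rw [h.eq_of_isAssociatedPartition hAB]
  exact h.isIRSet_iff
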